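/- Let $\alpha>0$, $t>0$ and $w(x,t)=(1-x^2)^\alpha e^{-t/(1-x^2)}$ for $x\in[-1,1]$. There is a unique sequence of monic polynomials $P_n(x,t)$, $n=0,1,2,\dots$, with $\deg P_n=n$ and $\int_{-1}^1P_m(x,t)P_n(x,t)w(x,t)\,dx=0$ for $m\neq n$, and there are unique real numbers $\beta_n=\beta_n(t)$ with $\beta_0=0$ and $xP_n=P_{n+1}+\beta_nP_{n-1}$ for all $n\ge 0$, where $P_{-1}=0$. **Theorem.** For every $n\ge 1$, with $$\tilde\beta_{n-1}:=(2n-3+2\alpha)\beta_{n-1}(t),\qquad \tilde\beta_{n+1}:=(2n+3+2\alpha)\beta_{n+1}(t),$$ the recurrence coefficients satisfy the second-order nonlinear difference equation $$\begin{aligned} &\Big\{\left[68(n+\alpha)^2-9\right]\beta_n^3+\big[12-80(n+\alpha)^2+(14n+5+14\alpha)\tilde\beta_{n-1}+(14n-5+14\alpha)\tilde\beta_{n+1}\big]\beta_n^2\\ &\quad+\big[24(n+\alpha)^2+4t(t-2\alpha)-3-2(2n+1+2\alpha)\tilde\beta_{n-1}-2(2n-1+2\alpha)\tilde\beta_{n+1}+\tilde\beta_{n-1}\tilde\beta_{n+1}\big]\beta_n\\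 &\quad-2\left[(n+\alpha)^2-t\alpha\right]\Big\}^2\\ &=4\Big\{2(2n-1+2\alpha)(2n+1+2\alpha)\beta_n^2+\big[(2n+1+2\alpha)\tilde\beta_{n-1}+(2n-1+2\alpha)\tilde\beta_{n+1}\\ &\quad-2(2n-1+2\alpha)(2n+1+2\alpha)\big]\beta_n+(n+\alpha)^2+t(t-2\alpha)\Big\}\\ &\quad\times\Big\{12(n+\alpha)\beta_n^2+\big[\tilde\beta_{n-1}+\tilde\beta_{n+1}-8(n+\alpha)\big]\beta_n+n+\alpha\Big\}^2 . \end{aligned}$$ The equation also holds for $n=0$, whatever real value is assigned to $\beta_{-1}$. -/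

import Mathlib

/-- The symmetric Pollaczek-Jacobi type weight `w(x,t) = (1 - x²)^α exp(-t / (1 - x²))`, used for
`x ∈ [-1, 1]`. For `0 < α` its value at `x = ±1` is `0`, because `0 ^ α = 0`. -/
noncomputable def pjWeight (α t x : ℝ) : ℝ :=
  (1 - x ^ 2) ^ α * Real.exp (-t / (1 - x ^ 2))

/-- `P 0, P 1, P 2, …` are the monic polynomials, `P n` of degree `n`, that are orthogonal on
`[-1, 1]` with respect to the weight `w(·,t)`. -/
structure IsMonicOrthogonal (α t : ℝ) (P : ℕ → Polynomial ℝ) : Prop where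
  monic : ∀ n, (P n).Monic
  natDegree_eq : ∀ n, (P n).natDegree = n
  orthogonal : ∀ m n, m ≠ n →
    ∫ x in (-1 : ℝ)..1, (P m).eval x * (P n).eval x * pjWeight α t x = 0

/-- `β n` are the coefficients of the three-term recurrence `x P_n = P_{n+1} + β_n P_{n-1}`, where
`P_{-1} = 0` and `β_0 = 0`. -/
structure IsRecurrenceCoeff (P : ℕ → Polynomial ℝ) (β : ℕ → ℝ) : Prop where
  beta_zero : β 0 = 0
  rec_zero : Polynomial.X * P 0 = P 1
  rec_succ : ∀ n, Polynomial.X * P (n + 1) = P (n + 2) + Polynomial.C (β (n + 1)) * P n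

/-- The algebraic relation of the second-order difference equation, between `b = β_n` and the scaled
neighbours `u` (for `n - 1`) and `v` (for `n + 1`). -/
def BetaRelation (α t : ℝ) (n : ℕ) (u b v : ℝ) : Prop :=
  ((68 * (n + α) ^ 2 - 9) * b ^ 3
    + (12 - 80 * (n + α) ^ 2 + (14 * n + 5 + 14 * α) * u + (14 * n - 5 + 14 * α) * v) * b ^ 2
    + (24 * (n + α) ^ 2 + 4 * t * (t - 2 * α) - 3 - 2 * (2 * n + 1 + 2 * α) * u
        - 2 * (2 * n - 1 + 2 * α) * v + u * v) * b
    - 2 * ((n + α) ^ 2 - t * α)) ^ 2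
  = 4 * (2 * (2 * n - 1 + 2 * α) * (2 * n + 1 + 2 * α) * b ^ 2
      + ((2 * n + 1 + 2 * α) * u + (2 * n - 1 + 2 * α) * v
          - 2 * (2 * n - 1 + 2 * α) * (2 * n + 1 + 2 * α)) * b
      + (n + α) ^ 2 + t * (t - 2 * α))
    * (12 * (n + α) * b ^ 2 + (u + v - 8 * (n + α)) * b + n + α) ^ 2

open Polynomial

/-! Since `(1 - x²)² w'/w` is a polynomial, integration by parts gives a Pearson identity for the
functional `L` of integration against `w` (`pjFunctional_pearson`). Apart from this, only positivity
and evenness of `L` matter. The Pearson identity forces `(1 - x²)² P_n'` to be a combination of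
`P_n` and `P_{n-1}` with polynomial coefficients that involve two numbers `r_n` and `c_n`
(`ladder`). Compatibility with the differentiated recurrence yields `β_{n+1} c_{n+1} - β_n c_{n-1} =
1` (`beta_mul_ladderC`). Together with the linear relations among `r`, `c` and `β`, this sums to two
algebraic identities for each `n` (`ladder_first_integrals`). Both `c_n` and `c_{n-1}` are affine in
`r_n`, so these are two equations for `r_n`; eliminating it gives the difference equation
(`betaRelation_of_first_integrals`). -/

/-! ### The weight, its functional and the Pearson identity -/

theorem pjWeight_neg (α t x : ℝ) : pjWeight α t (-x) = pjWeight α t x := by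
  simp [pjWeight]

theorem one_sub_sq_pos {x : ℝ} (hx : x ∈ Set.Ioo (-1 : ℝ) 1) : 0 < 1 - x ^ 2 := by
  nlinarith [hx.1, hx.2]

theorem pjWeight_pos (α t : ℝ) {x : ℝ} (hx : x ∈ Set.Ioo (-1 : ℝ) 1) : 0 < pjWeight α t x :=
  mul_pos (Real.rpow_pos_of_pos (one_sub_sq_pos hx) _) (Real.exp_pos _)

/-- At `±1` the convention `-t / 0 = 0` makes the exponential `1`, and only the factor `0 ^ α` gives
the value `0`. Near these points the exponential is at most `1`, so the weight is squeezed between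
`0` and `(1 - x²)^α`. -/
theorem continuousOn_pjWeight {α t : ℝ} (hα : 0 < α) (ht : 0 < t) :
    ContinuousOn (pjWeight α t) (Set.Icc (-1) 1) := by
  have hpow : Continuous fun x : ℝ => (1 - x ^ 2) ^ α :=
    (by fun_prop : Continuous fun x : ℝ => 1 - x ^ 2).rpow_const fun _ => Or.inr hα.le
  intro x hx
  by_cases h : 1 - x ^ 2 = 0
  · have hw : pjWeight α t x = 0 := by simp [pjWeight, h, hα.ne']
    rw [ContinuousWithinAt, hw]
    refine tendsto_of_tendsto_of_tendsto_of_le_of_le' tendsto_const_nhds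
      (h := fun y : ℝ => (1 - y ^ 2) ^ α) ?_ ?_ ?_
    · have := hpow.tendsto x
      simp only [h, Real.zero_rpow hα.ne'] at this
      exact this.mono_left nhdsWithin_le_nhds
    · filter_upwards [self_mem_nhdsWithin] with y hy
      have : 0 ≤ 1 - y ^ 2 := by nlinarith [hy.1, hy.2]
      exact mul_nonneg (Real.rpow_nonneg this _) (Real.exp_pos _).le
    · filter_upwards [self_mem_nhdsWithin] with y hy
      have h0 : 0 ≤ 1 - y ^ 2 := by nlinarith [hy.1, hy.2]
      refine mul_le_of_le_one_right (Real.rpow_nonneg h0 _) ?_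
      exact Real.exp_le_one_iff.2 (div_nonpos_of_nonpos_of_nonneg (by linarith) h0)
  · refine ContinuousAt.continuousWithinAt (hpow.continuousAt.mul ?_)
    exact (continuousAt_const.div (by fun_prop : ContinuousAt (fun y : ℝ => 1 - y ^ 2) x) h).rexp

theorem intervalIntegrable_eval_mul_pjWeight {α t : ℝ} (hα : 0 < α) (ht : 0 < t)
    (p : Polynomial ℝ) :
    IntervalIntegrable (fun x => p.eval x * pjWeight α t x) MeasureTheory.volume (-1) 1 := by
  apply ContinuousOn.intervalIntegrable
  rw [Set.uIcc_of_le (by norm_num)]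
  exact p.continuous.continuousOn.mul (continuousOn_pjWeight hα ht)

/-- Integration of a polynomial against `pjWeight α t`. -/
noncomputable def pjFunctional {α t : ℝ} (hα : 0 < α) (ht : 0 < t) : Polynomial ℝ →ₗ[ℝ] ℝ where
  toFun p := ∫ x in (-1 : ℝ)..1, p.eval x * pjWeight α t x
  map_add' p q := by
    simp only [Polynomial.eval_add, add_mul]
    exact intervalIntegral.integral_add (intervalIntegrable_eval_mul_pjWeight hα ht p)
      (intervalIntegrable_eval_mul_pjWeight hα ht q)
  map_smul' c p := by
    simp [mul_assoc]

theorem pjFunctional_apply {α t : ℝ} (hα : 0 < α) (ht : 0 < t) (p : Polynomial ℝ) :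
    pjFunctional hα ht p = ∫ x in (-1 : ℝ)..1, p.eval x * pjWeight α t x := rfl

theorem pjFunctional_mul_self_pos {α t : ℝ} (hα : 0 < α) (ht : 0 < t) {p : Polynomial ℝ}
    (hp : p ≠ 0) : 0 < pjFunctional hα ht (p * p) := by
  rw [pjFunctional_apply]
  have hint := (p * p).continuous.continuousOn.mul (continuousOn_pjWeight hα ht)
  -- A nonzero polynomial has finitely many roots, so some interior point avoids them.
  obtain ⟨c, hc, hroot⟩ := ((Set.Ioo_infinite (by norm_num : (-1 : ℝ) < 1)).sdiff
    p.roots.toFinset.finite_toSet).nonempty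
  have hpc : p.eval c ≠ 0 := fun h => hroot (by simpa [hp] using h)
  refine intervalIntegral.integral_pos (by norm_num) hint (fun x hx => ?_)
    ⟨c, Set.Ioo_subset_Icc_self hc, ?_⟩
  · have h0 : 0 ≤ 1 - x ^ 2 := by nlinarith [hx.1, hx.2]
    rw [Polynomial.eval_mul]
    exact mul_nonneg (mul_self_nonneg _)
      (mul_nonneg (Real.rpow_nonneg h0 _) (Real.exp_pos _).le)
  · rw [Polynomial.eval_mul]
    exact mul_pos (mul_self_pos.2 hpc) (pjWeight_pos α t hc)

theorem pjFunctional_comp_neg {α t : ℝ} (hα : 0 < α) (ht : 0 < t) (p : Polynomial ℝ) :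
    pjFunctional hα ht (p.comp (-Polynomial.X)) = pjFunctional hα ht p := by
  simp only [pjFunctional_apply]
  have := intervalIntegral.integral_comp_neg (a := -1) (b := 1)
    (fun x => p.eval x * pjWeight α t x)
  simpa [pjWeight_neg] using this

theorem hasDerivAt_pjWeight (α t : ℝ) {x : ℝ} (hx : x ∈ Set.Ioo (-1 : ℝ) 1) :
    HasDerivAt (pjWeight α t)
      (-2 * x * (α * (1 - x ^ 2) + t) / (1 - x ^ 2) ^ 2 * pjWeight α t x) x := by
  have hy := one_sub_sq_pos hx
  have h1 : HasDerivAt (fun x : ℝ => 1 - x ^ 2) (-(2 * x)) x := by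
    simpa using (hasDerivAt_pow 2 x).const_sub 1
  have h2 := h1.rpow_const (p := α) (Or.inl hy.ne')
  have h3 := ((hasDerivAt_const x (-t)).div h1 hy.ne').exp
  refine (h2.mul h3).congr_deriv ?_
  simp only [pjWeight, Pi.div_apply]
  rw [Real.rpow_sub_one hy.ne']
  field_simp
  ring

/-- The integrand is the derivative of `(1 - x²)² p w`, which vanishes at `±1`. The fundamental
theorem of calculus is used with continuity on the closed interval and differentiability only
inside. -/
theorem pjFunctional_pearson {α t : ℝ} (hα : 0 < α) (ht : 0 < t) (p : ℝ[X]) :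
    pjFunctional hα ht ((1 - X ^ 2) ^ 2 * derivative p
      + (C (4 + 2 * α) * X ^ 3 - C (4 + 2 * α + 2 * t) * X) * p) = 0 := by
  have hcont : ContinuousOn (fun x => (1 - x ^ 2) ^ 2 * p.eval x * pjWeight α t x)
      (Set.Icc (-1) 1) :=
    (by fun_prop : Continuous fun x => (1 - x ^ 2) ^ 2 * p.eval x).continuousOn.mul
      (continuousOn_pjWeight hα ht)
  rw [pjFunctional_apply, intervalIntegral.integral_eq_sub_of_hasDerivAt_of_le (by norm_num) hcont
    ?_ (intervalIntegrable_eval_mul_pjWeight hα ht _)]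
  · norm_num
  · intro x hx
    have hy := one_sub_sq_pos hx
    have h1 : HasDerivAt (fun x : ℝ => 1 - x ^ 2) (-(2 * x)) x := by
      simpa using (hasDerivAt_pow 2 x).const_sub 1
    refine (((h1.pow 2).mul (p.hasDerivAt x)).mul (hasDerivAt_pjWeight α t hx)).congr_deriv ?_
    simp only [Pi.mul_apply, Pi.pow_apply, eval_add, eval_sub, eval_mul, eval_pow, eval_C, eval_X,
      eval_one]
    field_simp
    push_cast
    ring

/-! ### Coefficients indexed by `ℤ`, so that shifts of degree hold without boundary cases -/

/-- The coefficient of `X ^ z`, for an integer `z`; it vanishes for negative `z`. -/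
noncomputable def intCoeff (p : ℝ[X]) (z : ℤ) : ℝ := if 0 ≤ z then p.coeff z.toNat else 0

theorem intCoeff_natCast (p : ℝ[X]) (n : ℕ) : intCoeff p n = p.coeff n := by
  simp [intCoeff]

theorem intCoeff_one (z : ℤ) : intCoeff 1 z = if z = 0 then 1 else 0 := by
  unfold intCoeff
  rcases lt_trichotomy z 0 with hz | rfl | hz
  · rw [if_neg (by omega), if_neg (by omega)]
  · simp
  · rw [if_pos (by omega), if_neg (by omega), coeff_one, if_neg (by omega)]

theorem intCoeff_add (p q : ℝ[X]) (z : ℤ) :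
    intCoeff (p + q) z = intCoeff p z + intCoeff q z := by
  unfold intCoeff; split_ifs <;> simp

theorem intCoeff_sub (p q : ℝ[X]) (z : ℤ) :
    intCoeff (p - q) z = intCoeff p z - intCoeff q z := by
  unfold intCoeff; split_ifs <;> simp

theorem intCoeff_C_mul (a : ℝ) (p : ℝ[X]) (z : ℤ) :
    intCoeff (C a * p) z = a * intCoeff p z := by
  unfold intCoeff; split_ifs <;> simp

theorem intCoeff_X_mul (p : ℝ[X]) (z : ℤ) : intCoeff (X * p) z = intCoeff p (z - 1) := by
  unfold intCoeff
  rcases lt_trichotomy z 0 with h | rfl | h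
  · rw [if_neg (by omega), if_neg (by omega)]
  · simp
  · obtain ⟨n, rfl⟩ : ∃ n : ℕ, z = n + 1 := ⟨(z - 1).toNat, by omega⟩
    rw [if_pos (by omega), if_pos (by omega), show ((n : ℤ) + 1).toNat = n + 1 by omega,
      show ((n : ℤ) + 1 - 1).toNat = n by omega, coeff_X_mul]

theorem intCoeff_derivative (p : ℝ[X]) (z : ℤ) :
    intCoeff (derivative p) z = (z + 1) * intCoeff p (z + 1) := by
  unfold intCoeff
  rcases lt_trichotomy z (-1) with h | rfl | h
  · rw [if_neg (by omega), if_neg (by omega), mul_zero]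
  · simp
  · obtain ⟨n, rfl⟩ : ∃ n : ℕ, z = n := ⟨z.toNat, by omega⟩
    rw [if_pos (by omega), if_pos (by omega), show ((n : ℤ) + 1).toNat = n + 1 by omega,
      coeff_derivative]
    simp [mul_comm]

/-! ### Orthogonal polynomials of a positive even functional -/

/-- `P n` are monic of degree `n` and pairwise orthogonal for the functional `L`. -/
structure IsMonicOrthogonalFor (L : ℝ[X] →ₗ[ℝ] ℝ) (P : ℕ → ℝ[X]) : Prop where
  monic : ∀ n, (P n).Monic
  natDegree_eq : ∀ n, (P n).natDegree = n
  orthogonal : ∀ m n, m ≠ n → L (P m * P n) = 0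

theorem map_C_mul (L : ℝ[X] →ₗ[ℝ] ℝ) (a : ℝ) (p : ℝ[X]) : L (C a * p) = a * L p := by
  rw [C_mul', map_smul, smul_eq_mul]

namespace IsMonicOrthogonalFor

variable {L : ℝ[X] →ₗ[ℝ] ℝ} {P : ℕ → ℝ[X]}

theorem degree_eq (h : IsMonicOrthogonalFor L P) (n : ℕ) : (P n).degree = n := by
  rw [degree_eq_natDegree (h.monic n).ne_zero, h.natDegree_eq]

theorem coeff_self (h : IsMonicOrthogonalFor L P) (n : ℕ) : (P n).coeff n = 1 := by
  have := h.monic n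
  rwa [Monic, leadingCoeff, h.natDegree_eq] at this

theorem coeff_of_lt (h : IsMonicOrthogonalFor L P) {n k : ℕ} (hk : n < k) :
    (P n).coeff k = 0 :=
  coeff_eq_zero_of_natDegree_lt (by rwa [h.natDegree_eq])

theorem apply_zero (h : IsMonicOrthogonalFor L P) : P 0 = 1 :=
  (h.monic 0).natDegree_eq_zero.1 (h.natDegree_eq 0)

/-- A functional that vanishes at `P 0, …, P (N - 1)` vanishes at every polynomial of degree less
than `N`. -/
theorem map_eq_zero_of_degree_lt (h : IsMonicOrthogonalFor L P) (M : ℝ[X] →ₗ[ℝ] ℝ) {N : ℕ}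
    (hM : ∀ k < N, M (P k) = 0) {q : ℝ[X]} (hq : q.degree < N) : M q = 0 := by
  induction N generalizing q with
  | zero =>
    have : q = 0 := by simpa [Nat.WithBot.lt_zero_iff] using hq
    simp [this]
  | succ N ih =>
    have hlt : (q - C (q.coeff N) * P N).degree < N := by
      rw [degree_lt_iff_coeff_zero] at hq ⊢
      intro m hm
      rcases hm.eq_or_lt with rfl | hm
      · simp [h.coeff_self]
      · simp [h.coeff_of_lt hm, hq m hm]
    have := ih (fun k hk => hM k (hk.trans N.lt_succ_self)) hlt
    rwa [map_sub, map_C_mul, hM N N.lt_succ_self, mul_zero, sub_zero] at this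

theorem map_mul_eq_zero (h : IsMonicOrthogonalFor L P) {n : ℕ} {q : ℝ[X]} (hq : q.degree < n) :
    L (P n * q) = 0 :=
  h.map_eq_zero_of_degree_lt (L ∘ₗ LinearMap.mulLeft ℝ (P n))
    (fun k hk => h.orthogonal n k hk.ne') hq

/-- Such a `q` is orthogonal to itself, contradicting positivity unless it vanishes. Uniqueness, the
recurrence and the ladder relation all rest on this criterion. -/
theorem eq_zero_of_degree_lt (h : IsMonicOrthogonalFor L P)
    (hpos : ∀ p : ℝ[X], p ≠ 0 → 0 < L (p * p)) {q : ℝ[X]} {n : ℕ} (hq : q.degree < n)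
    (hort : ∀ k < n, L (q * P k) = 0) : q = 0 := by
  by_contra hne
  exact (hpos q hne).ne'
    (h.map_eq_zero_of_degree_lt (L ∘ₗ LinearMap.mulLeft ℝ q) hort hq)

theorem unique (hpos : ∀ p : ℝ[X], p ≠ 0 → 0 < L (p * p)) {Q : ℕ → ℝ[X]}
    (h : IsMonicOrthogonalFor L P) (h' : IsMonicOrthogonalFor L Q) : P = Q := by
  funext n
  have hlt : (P n - Q n).degree < n := by
    rw [degree_lt_iff_coeff_zero]
    intro m hm
    rcases hm.eq_or_lt with rfl | hm
    · simp [h.coeff_self, h'.coeff_self]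
    · simp [h.coeff_of_lt hm, h'.coeff_of_lt hm]
  refine sub_eq_zero.1 (h.eq_zero_of_degree_lt hpos hlt fun k hk => ?_)
  have hk' : (P k).degree < n := by rw [h.degree_eq]; exact_mod_cast hk
  rw [sub_mul, map_sub, h.map_mul_eq_zero hk', h'.map_mul_eq_zero hk', sub_zero]

/-- Evenness of `L` makes `(-1)^n P_n(-x)` another monic orthogonal sequence; uniqueness identifies
the two. -/
theorem comp_neg (h : IsMonicOrthogonalFor L P) (hpos : ∀ p : ℝ[X], p ≠ 0 → 0 < L (p * p))
    (hsymm : ∀ p : ℝ[X], L (p.comp (-X)) = L p) (n : ℕ) :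
    (P n).comp (-X) = C ((-1) ^ n) * P n := by
  have h' : IsMonicOrthogonalFor L fun n => C ((-1) ^ n) * (P n).comp (-X) := by
    have hdeg : ∀ n, (C ((-1 : ℝ) ^ n) * (P n).comp (-X)).natDegree = n := fun n => by
      rw [natDegree_C_mul (by simp), natDegree_comp, h.natDegree_eq]; simp
    refine ⟨fun n => ?_, hdeg, fun m n hmn => ?_⟩
    · rw [Monic, leadingCoeff_mul, leadingCoeff_C, leadingCoeff_comp (by simp), h.natDegree_eq,
        (h.monic n).leadingCoeff]
      simp [← mul_pow]
    · rw [mul_mul_mul_comm, ← C_mul, map_C_mul, ← mul_comp, hsymm, h.orthogonal m n hmn, mul_zero]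
  have := congrFun (unique hpos h h') n
  nth_rw 2 [this]
  rw [← mul_assoc, ← C_mul, ← mul_pow]
  simp

/-- By parity `X * P n * P n` is odd. This is why the recurrence has no term in `P_n` itself. -/
theorem map_X_mul_self (h : IsMonicOrthogonalFor L P)
    (hpos : ∀ p : ℝ[X], p ≠ 0 → 0 < L (p * p))
    (hsymm : ∀ p : ℝ[X], L (p.comp (-X)) = L p) (n : ℕ) : L (X * P n * P n) = 0 := by
  have h1 := hsymm (X * P n * P n)
  rw [mul_comp, mul_comp, h.comp_neg hpos hsymm, X_comp] at h1
  have h2 : -X * (C ((-1) ^ n) * P n) * (C ((-1) ^ n) * P n)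
      = C (-((-1 : ℝ) ^ n * (-1) ^ n)) * (X * P n * P n) := by
    simp only [C_neg, C_mul]; ring
  rw [h2, map_C_mul, ← mul_pow] at h1
  norm_num at h1
  linarith

theorem map_mul_X_mul (h : IsMonicOrthogonalFor L P) (n : ℕ) :
    L (P (n + 1) * (X * P n)) = L (P (n + 1) * P (n + 1)) := by
  have hlt : (X * P n - P (n + 1)).degree < ((n + 1 : ℕ) : WithBot ℕ) := by
    rw [degree_lt_iff_coeff_zero]
    intro m hm
    obtain ⟨k, rfl⟩ := Nat.exists_eq_add_of_le' (Nat.one_le_of_lt (Nat.lt_of_succ_le hm))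
    rw [coeff_sub, coeff_X_mul]
    rcases (Nat.le_of_succ_le_succ hm).eq_or_lt with rfl | hk
    · simp [h.coeff_self]
    · simp [h.coeff_of_lt hk, h.coeff_of_lt (Nat.succ_lt_succ hk)]
  have := h.map_mul_eq_zero hlt
  rw [mul_sub, map_sub] at this
  linarith

theorem exists_recurrence (h : IsMonicOrthogonalFor L P)
    (hpos : ∀ p : ℝ[X], p ≠ 0 → 0 < L (p * p))
    (hsymm : ∀ p : ℝ[X], L (p.comp (-X)) = L p) (n : ℕ) :
    ∃ b : ℝ, X * P (n + 1) = P (n + 2) + C b * P n := by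
  -- The value forced by pairing the recurrence with `P n`.
  refine ⟨L (P (n + 1) * P (n + 1)) / L (P n * P n), ?_⟩
  set b := L (P (n + 1) * P (n + 1)) / L (P n * P n) with hb
  have hbn : b * L (P n * P n) = L (P (n + 1) * P (n + 1)) :=
    div_mul_cancel₀ _ (hpos _ (h.monic n).ne_zero).ne'
  have hlt : (X * P (n + 1) - (P (n + 2) + C b * P n)).degree < ((n + 2 : ℕ) : WithBot ℕ) := by
    rw [degree_lt_iff_coeff_zero]
    intro m hm
    obtain ⟨k, rfl⟩ := Nat.exists_eq_add_of_le' (Nat.one_le_of_lt (Nat.lt_of_succ_le hm))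
    rw [coeff_sub, coeff_X_mul, coeff_add, coeff_C_mul, h.coeff_of_lt (by omega : n < k + 1)]
    rcases (Nat.le_of_succ_le_succ hm).eq_or_lt with rfl | hk
    · simp [h.coeff_self]
    · simp [h.coeff_of_lt hk, h.coeff_of_lt (Nat.succ_lt_succ hk)]
  refine sub_eq_zero.1 (h.eq_zero_of_degree_lt hpos hlt fun k hk => ?_)
  rw [sub_mul, add_mul, map_sub, map_add, mul_assoc (C b), map_C_mul,
    h.orthogonal (n + 2) k (by omega)]
  rcases (by omega : k < n ∨ k = n ∨ k = n + 1) with hk | rfl | rfl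
  · have hd : (X * P k).degree < ((n + 1 : ℕ) : WithBot ℕ) := by
      rw [degree_mul, degree_X, h.degree_eq, add_comm]; exact_mod_cast Nat.succ_lt_succ hk
    rw [h.orthogonal n k hk.ne', show X * P (n + 1) * P k = P (n + 1) * (X * P k) by ring,
      h.map_mul_eq_zero hd]
    simp
  · rw [show X * P (k + 1) * P k = P (k + 1) * (X * P k) by ring, h.map_mul_X_mul, hbn]
    simp
  · rw [h.orthogonal n (n + 1) (by omega), h.map_X_mul_self hpos hsymm]
    simp

theorem X_mul_zero (h : IsMonicOrthogonalFor L P)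
    (hpos : ∀ p : ℝ[X], p ≠ 0 → 0 < L (p * p))
    (hsymm : ∀ p : ℝ[X], L (p.comp (-X)) = L p) : X * P 0 = P 1 := by
  have hlt : (X * P 0 - P 1).degree < ((1 : ℕ) : WithBot ℕ) := by
    rw [degree_lt_iff_coeff_zero]
    intro m hm
    obtain ⟨k, rfl⟩ := Nat.exists_eq_add_of_le' hm
    rw [coeff_sub, coeff_X_mul]
    rcases k.eq_zero_or_pos with rfl | hk
    · simp [h.coeff_self]
    · simp [h.coeff_of_lt hk, h.coeff_of_lt (Nat.succ_lt_succ hk)]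
  refine sub_eq_zero.1 (h.eq_zero_of_degree_lt hpos hlt fun k hk => ?_)
  obtain rfl : k = 0 := by omega
  rw [sub_mul, map_sub, h.map_X_mul_self hpos hsymm, h.orthogonal 1 0 one_ne_zero, sub_zero]

end IsMonicOrthogonalFor

/-! ### Existence of the orthogonal polynomials -/

/-- Positivity makes the pairing on polynomials of degree below `n` nondegenerate, so by finite
dimension some `q` there represents pairing with `X ^ n`; then `X ^ n - q` is the required
polynomial. -/
theorem exists_monic_orthogonal (L : ℝ[X] →ₗ[ℝ] ℝ)
    (hpos : ∀ p : ℝ[X], p ≠ 0 → 0 < L (p * p)) (n : ℕ) :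
    ∃ p : ℝ[X], p.Monic ∧ p.natDegree = n ∧ ∀ q : ℝ[X], q.degree < n → L (p * q) = 0 := by
  let B : degreeLT ℝ n →ₗ[ℝ] Module.Dual ℝ (degreeLT ℝ n) :=
    ((LinearMap.mul ℝ ℝ[X]).compr₂ L).domRestrict₁₂ (degreeLT ℝ n) (degreeLT ℝ n)
  have hB : ∀ p q, B p q = L ((p : ℝ[X]) * q) := fun p q => rfl
  have : FiniteDimensional ℝ (degreeLT ℝ n) := Module.Finite.equiv (degreeLTEquiv ℝ n).symm
  have hinj : Function.Injective B := by
    rw [injective_iff_map_eq_zero]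
    intro p hp
    by_contra hne
    have h0 : (p : ℝ[X]) ≠ 0 := fun h => hne (Subtype.ext h)
    exact (hpos p h0).ne' (by rw [← hB, hp]; rfl)
  have hsurj : Function.Surjective B :=
    (LinearMap.injective_iff_surjective_of_finrank_eq_finrank
      Subspace.dual_finrank_eq.symm).1 hinj
  obtain ⟨q, hq⟩ := hsurj ((L ∘ₗ LinearMap.mulLeft ℝ (X ^ n)) ∘ₗ (degreeLT ℝ n).subtype)
  have hqd : (q : ℝ[X]).degree < (X ^ n : ℝ[X]).degree := by
    rw [degree_X_pow]; exact mem_degreeLT.1 q.2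
  refine ⟨X ^ n - (q : ℝ[X]), (monic_X_pow n).sub_of_left hqd, ?_, fun p hp => ?_⟩
  · exact natDegree_eq_of_degree_eq_some
      ((degree_sub_eq_left_of_degree_lt hqd).trans (degree_X_pow n))
  · have := LinearMap.congr_fun hq ⟨p, mem_degreeLT.2 hp⟩
    rw [hB] at this
    rw [sub_mul, map_sub, this]
    simp

theorem exists_isMonicOrthogonalFor (L : ℝ[X] →ₗ[ℝ] ℝ)
    (hpos : ∀ p : ℝ[X], p ≠ 0 → 0 < L (p * p)) : ∃ P, IsMonicOrthogonalFor L P := by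
  choose P hmon hdeg hort using exists_monic_orthogonal L hpos
  have key : ∀ m n, m < n → L (P n * P m) = 0 := fun m n hmn => by
    refine hort n _ ?_
    rw [degree_eq_natDegree (hmon m).ne_zero, hdeg]
    exact_mod_cast hmn
  refine ⟨P, hmon, hdeg, fun m n hmn => ?_⟩
  rcases hmn.lt_or_gt with h | h
  · rw [mul_comm, key m n h]
  · exact key n m h

/-! ### The ladder relation and its compatibility with the recurrence -/

namespace IsMonicOrthogonalFor

variable {L : ℝ[X] →ₗ[ℝ] ℝ} {P : ℕ → ℝ[X]} {β : ℕ → ℝ}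

theorem norm_succ (h : IsMonicOrthogonalFor L P)
    (hrec : ∀ n, X * P n = P (n + 1) + C (β n) * P (n - 1)) (n : ℕ) :
    L (P (n + 1) * P (n + 1)) = β (n + 1) * L (P n * P n) := by
  rw [← h.map_mul_X_mul, show P (n + 1) * (X * P n) = P n * (X * P (n + 1)) by ring,
    hrec (n + 1), mul_add, map_add, h.orthogonal n (n + 1 + 1) (by omega), mul_left_comm, map_C_mul]
  simp

/-- Each factor `X` is absorbed into `P n` by the recurrence; the last moment then accumulates one
`β` for each step in `n`. -/
theorem map_mul_X_pow (h : IsMonicOrthogonalFor L P)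
    (hrec : ∀ n, X * P n = P (n + 1) + C (β n) * P (n - 1)) (h0 : β 0 = 0) (n : ℕ) :
    L (P n * X ^ n) = L (P n * P n) ∧ L (P n * X ^ (n + 1)) = 0 ∧
      L (P n * X ^ (n + 2)) = L (P n * P n) * ∑ j ∈ Finset.range (n + 2), β j := by
  have hstep : ∀ n k, L (P n * X ^ (k + 1)) = L (P (n + 1) * X ^ k)
      + β n * L (P (n - 1) * X ^ k) := fun n k => by
    rw [show P n * X ^ (k + 1) = X * P n * X ^ k by ring, hrec, add_mul, mul_assoc, map_add,
      map_C_mul]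
  have hself : ∀ n, L (P n * X ^ n) = L (P n * P n) := fun n => by
    have hlt : (X ^ n - P n).degree < (n : WithBot ℕ) := by
      rw [degree_lt_iff_coeff_zero]
      intro m hm
      rcases hm.eq_or_lt with rfl | hm
      · simp [h.coeff_self]
      · simp [h.coeff_of_lt hm, coeff_X_pow, hm.ne']
    have := h.map_mul_eq_zero hlt
    rw [mul_sub, map_sub] at this
    linarith
  have hlow : ∀ n, L (P (n + 1) * X ^ n) = 0 := fun n =>
    h.map_mul_eq_zero (by rw [degree_X_pow]; exact_mod_cast n.lt_succ_self)
  have hone : ∀ n, L (P n * X ^ (n + 1)) = 0 := fun n => by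
    induction n with
    | zero => rw [hstep, hlow, h0]; simp
    | succ n ih => rw [hstep, hlow, Nat.add_sub_cancel, ih]; simp
  refine ⟨hself n, hone n, ?_⟩
  clear hone hlow
  induction n with
  | zero =>
    rw [hstep, zero_add, zero_add, hself, h.norm_succ hrec]
    simp [Finset.sum_range_succ, h0, mul_comm]
  | succ n ih =>
    rw [hstep, hself, Nat.add_sub_cancel, ih, h.norm_succ hrec, h.norm_succ hrec,
      Finset.sum_range_succ _ (n + 2)]
    ring

/-- Pairing `P n` with a polynomial of degree at most `n + 2`. -/
theorem map_mul_eq (h : IsMonicOrthogonalFor L P)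
    (hrec : ∀ n, X * P n = P (n + 1) + C (β n) * P (n - 1)) (h0 : β 0 = 0) (n : ℕ) {q : ℝ[X]}
    (hq : ∀ z : ℤ, (n : ℤ) + 2 < z → intCoeff q z = 0) :
    L (P n * q) = L (P n * P n)
      * (intCoeff q n + (∑ j ∈ Finset.range (n + 2), β j) * intCoeff q (n + 2)) := by
  obtain ⟨m0, m1, m2⟩ := h.map_mul_X_pow hrec h0 n
  have hlt : (q - (C (q.coeff n) * X ^ n + C (q.coeff (n + 1)) * X ^ (n + 1)
      + C (q.coeff (n + 2)) * X ^ (n + 2))).degree < (n : WithBot ℕ) := by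
    rw [degree_lt_iff_coeff_zero]
    intro m hm
    simp only [coeff_sub, coeff_add, coeff_C_mul, coeff_X_pow]
    rcases (by omega : m = n ∨ m = n + 1 ∨ m = n + 2 ∨ n + 2 < m) with rfl | rfl | rfl | hm
    · simp
    · simp
    · simp
    · have := hq m (by exact_mod_cast hm)
      rw [intCoeff_natCast] at this
      rw [if_neg (by omega), if_neg (by omega), if_neg (by omega), this]
      simp
  have := h.map_mul_eq_zero hlt
  simp only [mul_sub, mul_add, map_sub, map_add, mul_left_comm (P n), map_C_mul, m0, m1, m2] at this
  have e : intCoeff q ((n : ℤ) + 2) = q.coeff (n + 2) := by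
    rw [← intCoeff_natCast]; norm_num
  rw [e, intCoeff_natCast]
  linarith

theorem intCoeff_of_gt (h : IsMonicOrthogonalFor L P) {n : ℕ} {z : ℤ} (hz : (n : ℤ) < z) :
    intCoeff (P n) z = 0 := by
  lift z to ℕ using by omega
  rw [intCoeff_natCast, h.coeff_of_lt (by exact_mod_cast hz)]

theorem intCoeff_self (h : IsMonicOrthogonalFor L P) (n : ℕ) : intCoeff (P n) n = 1 := by
  rw [intCoeff_natCast, h.coeff_self]

theorem intCoeff_of_odd (h : IsMonicOrthogonalFor L P)
    (hrec : ∀ n, X * P n = P (n + 1) + C (β n) * P (n - 1)) (h0 : β 0 = 0) (n : ℕ) {z : ℤ}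
    (hz : Odd (z - n)) : intCoeff (P n) z = 0 := by
  have hstep : ∀ n z, intCoeff (P (n + 1)) z
      = intCoeff (P n) (z - 1) - β n * intCoeff (P (n - 1)) z := fun n z => by
    rw [← intCoeff_X_mul, hrec, intCoeff_add, intCoeff_C_mul]; ring
  induction n using Nat.strong_induction_on generalizing z with
  | _ n ih =>
    rcases n with _ | _ | n
    · rw [h.apply_zero, intCoeff_one, if_neg]
      rintro rfl
      simp at hz
    · rw [hstep, ih 0 (by omega), h0]
      · simp
      · rw [Int.odd_iff] at hz ⊢; omega
    · rw [hstep, ih (n + 1) (by omega), ih (n + 1 - 1) (by omega)]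
      · simp
      all_goals rw [Int.odd_iff] at hz ⊢; omega

theorem intCoeff_sub_two (h : IsMonicOrthogonalFor L P)
    (hrec : ∀ n, X * P n = P (n + 1) + C (β n) * P (n - 1)) (h0 : β 0 = 0) (n : ℕ) :
    intCoeff (P n) ((n : ℤ) - 2) = -∑ j ∈ Finset.range n, β j := by
  induction n with
  | zero => simp [intCoeff]
  | succ n ih =>
    have e : intCoeff (P (n + 1)) ((n + 1 : ℕ) - 2)
        = intCoeff (P n) ((n : ℤ) - 2) - β n * intCoeff (P (n - 1)) ((n : ℤ) - 1) := by
      have := congrArg (fun p => intCoeff p ((n : ℤ) - 1)) (hrec n)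
      simp only [intCoeff_X_mul, intCoeff_add, intCoeff_C_mul] at this
      rw [show ((n + 1 : ℕ) : ℤ) - 2 = n - 1 by push_cast; ring,
        show (n : ℤ) - 2 = n - 1 - 1 by ring, this]
      ring
    have e2 : β n * intCoeff (P (n - 1)) ((n : ℤ) - 1) = β n := by
      rcases n with _ | n
      · simp [h0]
      · rw [Nat.add_sub_cancel, show ((n + 1 : ℕ) : ℤ) - 1 = n by push_cast; ring,
          h.intCoeff_self, mul_one]
    rw [e, ih, e2, Finset.sum_range_succ]
    ring

/-- The number `r_n` in the coefficient `n x³ - r_n x` of `P n` in the ladder relation. -/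
noncomputable def ladderR (α : ℝ) (β : ℕ → ℝ) (n : ℕ) : ℝ :=
  2 * n - (2 * n + 1 + 2 * α) * β n - 2 * ∑ j ∈ Finset.range n, β j

/-- The number `c_n` in the coefficient `β n (-(2n + 1 + 2α) x² + c_n)` of `P (n - 1)` in the
ladder relation. -/
noncomputable def ladderC (α t : ℝ) (β : ℕ → ℝ) (n : ℕ) : ℝ :=
  ladderR α β n + ladderR α β (n + 1) + 2 * (α + t)

/-- The coefficients in degrees `m + 4` and `m + 2` cancel by the leading term `(m + 1) X ^ 3` and
the choice of `ladderR`; those in degrees `m + 3` and `m + 1` vanish by parity. -/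
theorem ladder_sub_degree_lt (h : IsMonicOrthogonalFor L P)
    (hrec : ∀ n, X * P n = P (n + 1) + C (β n) * P (n - 1)) (h0 : β 0 = 0) (α t : ℝ) (m : ℕ) :
    ((1 - X ^ 2) ^ 2 * derivative (P (m + 1))
      - (C ((m : ℝ) + 1) * X ^ 3 - C (ladderR α β (m + 1)) * X) * P (m + 1)
      - C (β (m + 1)) * (C (-(2 * (m + 1) + 1 + 2 * α)) * X ^ 2 + C (ladderC α t β (m + 1)))
        * P m).degree < ((m + 1 : ℕ) : WithBot ℕ) := by
  rw [degree_lt_iff_coeff_zero]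
  intro k hk
  rw [← intCoeff_natCast]
  generalize hc : ladderC α t β (m + 1) = c
  generalize hr : ladderR α β (m + 1) = r
  have hsum := h.intCoeff_sub_two hrec h0 (m + 1)
  rw [show (1 - X ^ 2) ^ 2 * derivative (P (m + 1))
      - (C ((m : ℝ) + 1) * X ^ 3 - C r * X) * P (m + 1)
      - C (β (m + 1)) * (C (-(2 * (m + 1) + 1 + 2 * α)) * X ^ 2 + C c) * P m
    = derivative (P (m + 1)) - C 2 * (X * (X * derivative (P (m + 1))))
      + X * (X * (X * (X * derivative (P (m + 1)))))
      - C ((m : ℝ) + 1) * (X * (X * (X * P (m + 1)))) + C r * (X * P (m + 1))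
      - C (β (m + 1)) * (C (-(2 * (m + 1) + 1 + 2 * α)) * (X * (X * P m)) + C c * P m) by
    rw [show (C 2 : ℝ[X]) = 2 from rfl]; ring]
  simp only [intCoeff_add, intCoeff_sub, intCoeff_C_mul, intCoeff_X_mul, intCoeff_derivative]
  have odd₁ : ∀ z : ℤ, Odd (z - (m + 1 : ℕ)) → intCoeff (P (m + 1)) z = 0 :=
    fun z => h.intCoeff_of_odd hrec h0 (m + 1)
  have odd₀ : ∀ z : ℤ, Odd (z - m) → intCoeff (P m) z = 0 :=
    fun z => h.intCoeff_of_odd hrec h0 m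
  have gt₁ : ∀ z : ℤ, (m + 1 : ℕ) < z → intCoeff (P (m + 1)) z = 0 :=
    fun z => h.intCoeff_of_gt
  have gt₀ : ∀ z : ℤ, (m : ℤ) < z → intCoeff (P m) z = 0 := fun z => h.intCoeff_of_gt
  have self₁ : ∀ z : ℤ, z = (m + 1 : ℕ) → intCoeff (P (m + 1)) z = 1 :=
    fun z hz => hz ▸ h.intCoeff_self (m + 1)
  have self₀ : ∀ z : ℤ, z = m → intCoeff (P m) z = 1 := fun z hz => hz ▸ h.intCoeff_self m
  have two₁ : ∀ z : ℤ, z = m - 1 →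
      intCoeff (P (m + 1)) z = -∑ j ∈ Finset.range (m + 1), β j := fun z hz => by
    rw [← hsum]; congr 1; omega
  obtain ⟨d, rfl⟩ := Nat.exists_eq_add_of_le hk
  rcases (by omega : d = 1 ∨ d = 0 ∨ d = 2 ∨ d = 3 ∨ 4 ≤ d) with rfl | rfl | rfl | rfl | hd
  · rw [gt₁ (_ + 1), self₁ (_ - 1 - 1 + 1), two₁ (_ - 1 - 1 - 1 - 1 + 1), two₁ (_ - 1 - 1 - 1),
      self₁ (_ - 1), self₀ (_ - 1 - 1), gt₀]
    · rw [← hr, ladderR]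
      push_cast
      ring
    all_goals omega
  · rw [odd₁, odd₁, odd₁, odd₁, odd₁, odd₀, odd₀]
    · ring
    all_goals rw [Int.odd_iff]; omega
  · rw [odd₁, odd₁, odd₁, odd₁, odd₁, odd₀, odd₀]
    · ring
    all_goals rw [Int.odd_iff]; omega
  · rw [gt₁ (_ + 1), gt₁ (_ - 1 - 1 + 1), self₁ (_ - 1 - 1 - 1 - 1 + 1), self₁ (_ - 1 - 1 - 1),
      gt₁ (_ - 1), gt₀ (_ - 1 - 1), gt₀]
    · push_cast
      ring
    all_goals omega
  · rw [gt₁, gt₁, gt₁, gt₁, gt₁, gt₀, gt₀]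
    · ring
    all_goals omega

/-- The Pearson identity moves the derivative from `P (m + 1)` to `P k`, leaving `P (m + 1)` and `P
m` paired with polynomials `G` and `H` of low degree, of which only top coefficients count. -/
theorem map_ladder_sub_mul (h : IsMonicOrthogonalFor L P)
    (hrec : ∀ n, X * P n = P (n + 1) + C (β n) * P (n - 1)) (h0 : β 0 = 0) {α t : ℝ}
    (hpearson : ∀ p : ℝ[X], L ((1 - X ^ 2) ^ 2 * derivative p
      + (C (4 + 2 * α) * X ^ 3 - C (4 + 2 * α + 2 * t) * X) * p) = 0)
    {m k : ℕ} (hk : k ≤ m) :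
    L (((1 - X ^ 2) ^ 2 * derivative (P (m + 1))
      - (C ((m : ℝ) + 1) * X ^ 3 - C (ladderR α β (m + 1)) * X) * P (m + 1)
      - C (β (m + 1)) * (C (-(2 * (m + 1) + 1 + 2 * α)) * X ^ 2 + C (ladderC α t β (m + 1)))
        * P m) * P k) = 0 := by
  have hc : ladderC α t β (m + 1) = ladderR α β (m + 1) + ladderR α β (m + 1 + 1) + 2 * (α + t) :=
    rfl
  have hr' : ladderR α β (m + 1 + 1) = 2 * (m + 2) - (2 * m + 5 + 2 * α) * β (m + 2)
      - 2 * (∑ j ∈ Finset.range (m + 1), β j + β (m + 1)) := by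
    rw [ladderR, Finset.sum_range_succ]; push_cast; ring
  have hr : ladderR α β (m + 1) = 2 * (m + 1) - (2 * m + 3 + 2 * α) * β (m + 1)
      - 2 * ∑ j ∈ Finset.range (m + 1), β j := by
    rw [ladderR]; push_cast; ring
  rw [hr'] at hc
  generalize ladderC α t β (m + 1) = c at hc ⊢
  generalize ladderR α β (m + 1) = r at hc hr ⊢
  set G : ℝ[X] := derivative (P k) - C 2 * (X * (X * derivative (P k)))
    + X * (X * (X * (X * derivative (P k)))) + C (4 + 2 * α + m + 1) * (X * (X * (X * P k)))
    - C (4 + 2 * α + 2 * t + r) * (X * P k) with hG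
  set H : ℝ[X] := C (-(2 * (m + 1) + 1 + 2 * α)) * (X * (X * P k)) + C c * P k with hH
  have hsplit : ((1 - X ^ 2) ^ 2 * derivative (P (m + 1))
      - (C ((m : ℝ) + 1) * X ^ 3 - C r * X) * P (m + 1)
      - C (β (m + 1)) * (C (-(2 * (m + 1) + 1 + 2 * α)) * X ^ 2 + C c) * P m) * P k
      = ((1 - X ^ 2) ^ 2 * derivative (P (m + 1) * P k)
        + (C (4 + 2 * α) * X ^ 3 - C (4 + 2 * α + 2 * t) * X) * (P (m + 1) * P k))
        - P (m + 1) * G - C (β (m + 1)) * (P m * H) := by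
    rw [hG, hH, derivative_mul, show C (4 + 2 * α + m + 1) = C (4 + 2 * α) + C ((m : ℝ) + 1) by
      rw [← C_add]; ring_nf, C_add (a := 4 + 2 * α + 2 * t), show (C 2 : ℝ[X]) = 2 from rfl]
    ring
  have gt : ∀ z : ℤ, (k : ℤ) < z → intCoeff (P k) z = 0 := fun z => h.intCoeff_of_gt
  have odd : ∀ z : ℤ, Odd (z - k) → intCoeff (P k) z = 0 :=
    fun z => h.intCoeff_of_odd hrec h0 k
  have self : ∀ z : ℤ, z = k → intCoeff (P k) z = 1 := fun z hz => hz ▸ h.intCoeff_self k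
  have two : ∀ z : ℤ, z = k - 2 → intCoeff (P k) z = -∑ j ∈ Finset.range k, β j :=
    fun z hz => by rw [← h.intCoeff_sub_two hrec h0 k]; congr 1
  have hGz : ∀ z : ℤ, ((m + 1 : ℕ) : ℤ) + 2 < z → intCoeff G z = 0 := fun z hz => by
    simp only [hG, intCoeff_add, intCoeff_sub, intCoeff_C_mul, intCoeff_X_mul,
      intCoeff_derivative]
    rw [gt, gt, gt, gt, gt]
    · ring
    all_goals omega
  have hHz : ∀ z : ℤ, (m : ℤ) + 2 < z → intCoeff H z = 0 := fun z hz => by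
    simp only [hH, intCoeff_add, intCoeff_C_mul, intCoeff_X_mul]
    rw [gt, gt]
    · ring
    all_goals omega
  rw [hsplit, map_sub, map_sub, hpearson, map_C_mul, h.map_mul_eq hrec h0 _ hGz,
    h.map_mul_eq hrec h0 _ hHz, h.norm_succ hrec]
  -- Both pairings carry the common factor `β (m + 1) * L (P m * P m)`, by `norm_succ`.
  suffices hs : intCoeff G ((m + 1 : ℕ) : ℤ)
      + (∑ j ∈ Finset.range (m + 3), β j) * intCoeff G (((m + 1 : ℕ) : ℤ) + 2)
      + intCoeff H (m : ℤ) + (∑ j ∈ Finset.range (m + 2), β j) * intCoeff H ((m : ℤ) + 2) = 0 by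
    linear_combination (-β (m + 1) * L (P m * P m)) * hs
  simp only [hG, hH, intCoeff_add, intCoeff_sub, intCoeff_C_mul, intCoeff_X_mul,
    intCoeff_derivative]
  obtain ⟨d, rfl⟩ := Nat.exists_eq_add_of_le hk
  -- With `d = m - k`: `d = 0` fixes `ladderC`, `d = 2` fixes the factor `-(2n + 1 + 2α)` with `n =
  -- m + 1`, `d = 1` is parity, and larger `d` is orthogonality.
  rcases (by omega : d = 0 ∨ d = 1 ∨ d = 2 ∨ 3 ≤ d) with rfl | rfl | rfl | hd
  · simp only [Nat.add_zero] at *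
    rw [gt (((k + 1 : ℕ) : ℤ) + 1), self (((k + 1 : ℕ) : ℤ) - 1 - 1 + 1),
      two (((k + 1 : ℕ) : ℤ) - 1 - 1 - 1 - 1 + 1), two (((k + 1 : ℕ) : ℤ) - 1 - 1 - 1),
      self (((k + 1 : ℕ) : ℤ) - 1), gt (((k + 1 : ℕ) : ℤ) + 2 + 1),
      gt (((k + 1 : ℕ) : ℤ) + 2 - 1 - 1 + 1), self (((k + 1 : ℕ) : ℤ) + 2 - 1 - 1 - 1 - 1 + 1),
      self (((k + 1 : ℕ) : ℤ) + 2 - 1 - 1 - 1), gt (((k + 1 : ℕ) : ℤ) + 2 - 1),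
      two ((k : ℤ) - 1 - 1), self (k : ℤ), self ((k : ℤ) + 2 - 1 - 1), gt ((k : ℤ) + 2)]
    · rw [hc, hr]
      simp only [Finset.sum_range_succ]
      push_cast
      ring
    all_goals omega
  · rw [odd, odd, odd, odd, odd, odd, odd, odd, odd, odd, odd, odd, odd, odd]
    · ring
    all_goals rw [Int.odd_iff]; omega
  · rw [gt (((k + 2 + 1 : ℕ) : ℤ) + 1), gt (((k + 2 + 1 : ℕ) : ℤ) - 1 - 1 + 1),
      self (((k + 2 + 1 : ℕ) : ℤ) - 1 - 1 - 1 - 1 + 1), self (((k + 2 + 1 : ℕ) : ℤ) - 1 - 1 - 1),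
      gt (((k + 2 + 1 : ℕ) : ℤ) - 1), gt (((k + 2 + 1 : ℕ) : ℤ) + 2 + 1),
      gt (((k + 2 + 1 : ℕ) : ℤ) + 2 - 1 - 1 + 1), gt (((k + 2 + 1 : ℕ) : ℤ) + 2 - 1 - 1 - 1 - 1 + 1),
      gt (((k + 2 + 1 : ℕ) : ℤ) + 2 - 1 - 1 - 1), gt (((k + 2 + 1 : ℕ) : ℤ) + 2 - 1),
      self (((k + 2 : ℕ) : ℤ) - 1 - 1), gt ((k + 2 : ℕ) : ℤ), gt (((k + 2 : ℕ) : ℤ) + 2 - 1 - 1),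
      gt (((k + 2 : ℕ) : ℤ) + 2)]
    · push_cast
      ring
    all_goals omega
  · rw [gt, gt, gt, gt, gt, gt, gt, gt, gt, gt, gt, gt, gt, gt]
    · ring
    all_goals omega

/-- The ladder (structure) relation of the orthogonal polynomials. -/
theorem ladder (h : IsMonicOrthogonalFor L P) (hpos : ∀ p : ℝ[X], p ≠ 0 → 0 < L (p * p))
    (hrec : ∀ n, X * P n = P (n + 1) + C (β n) * P (n - 1)) (h0 : β 0 = 0) {α t : ℝ}
    (hpearson : ∀ p : ℝ[X], L ((1 - X ^ 2) ^ 2 * derivative p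
      + (C (4 + 2 * α) * X ^ 3 - C (4 + 2 * α + 2 * t) * X) * p) = 0) (n : ℕ) :
    (1 - X ^ 2) ^ 2 * derivative (P n)
      = (C (n : ℝ) * X ^ 3 - C (ladderR α β n) * X) * P n
        + C (β n) * (C (-(2 * n + 1 + 2 * α)) * X ^ 2 + C (ladderC α t β n)) * P (n - 1) := by
  rcases n with _ | m
  · simp [h.apply_zero, h0, ladderR]
  · have := h.eq_zero_of_degree_lt hpos (h.ladder_sub_degree_lt hrec h0 α t m)
      fun k hk => h.map_ladder_sub_mul hrec h0 hpearson (Nat.le_of_lt_succ hk)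
    rw [sub_sub, sub_eq_zero] at this
    simpa using this

theorem ladderR_succ (α : ℝ) (β : ℕ → ℝ) (n : ℕ) :
    ladderR α β (n + 1) = ladderR α β n + 2 - (2 * n + 3 + 2 * α) * β (n + 1)
      + (2 * n - 1 + 2 * α) * β n := by
  simp only [ladderR, Finset.sum_range_succ]
  push_cast
  ring

/-- Differentiate `x P_n = P_{n+1} + β_n P_{n-1}`, multiply by `(1 - x²)²`, replace each derivative
by its ladder relation and reduce by the recurrence. What remains is a constant times `P_n`, so the
constant is zero. -/
theorem beta_mul_ladderC (h : IsMonicOrthogonalFor L P)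
    (hpos : ∀ p : ℝ[X], p ≠ 0 → 0 < L (p * p))
    (hrec : ∀ n, X * P n = P (n + 1) + C (β n) * P (n - 1)) (h0 : β 0 = 0) {α t : ℝ}
    (hpearson : ∀ p : ℝ[X], L ((1 - X ^ 2) ^ 2 * derivative p
      + (C (4 + 2 * α) * X ^ 3 - C (4 + 2 * α + 2 * t) * X) * p) = 0) (n : ℕ) :
    β (n + 1) * ladderC α t β (n + 1) - β n * ladderC α t β (n - 1) = 1 := by
  have hlad := h.ladder hpos hrec h0 hpearson
  rcases n with _ | m
  -- For `n = 0` the term with the truncated index carries `β 0 = 0`, and the ladder relation of `P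
  -- 1 = X` at `x = 0` reads `1 = β 1 * c_1`.
  · have h1 := congrArg (eval 0) (hlad 1)
    have hP1 : P 1 = X := by simpa [h.apply_zero, h0] using (hrec 0).symm
    simp [hP1, h.apply_zero] at h1
    simp [h0, ← h1]
  · have key : C (1 - β (m + 2) * ladderC α t β (m + 2) + β (m + 1) * ladderC α t β m)
        * P (m + 1) = 0 := by
      refine Polynomial.funext fun x => ?_
      have R1 := congrArg (eval x) (hrec (m + 1))
      have R0 := congrArg (eval x) (hrec m)
      have D1 := congrArg (fun p => eval x (derivative p)) (hrec (m + 1))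
      have L2 := congrArg (eval x) (hlad (m + 2))
      have L1 := congrArg (eval x) (hlad (m + 1))
      have L0 := congrArg (eval x) (hlad m)
      have hr2 := ladderR_succ α β (m + 1)
      have hc1 : ladderC α t β (m + 1)
        = ladderR α β (m + 1) + ladderR α β (m + 1 + 1) + 2 * (α + t) := rfl
      have hc0 : ladderC α t β m = ladderR α β m + ladderR α β (m + 1) + 2 * (α + t) := rfl
      simp only [derivative_mul, derivative_X, derivative_add, derivative_C, eval_mul, eval_add,
        eval_sub, eval_pow, eval_X, eval_C, eval_one, eval_zero, Nat.add_sub_cancel,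
        show m + 2 - 1 = m + 1 from rfl, show m + 1 + 1 = m + 2 from rfl, zero_mul, one_mul,
        zero_add] at R1 R0 D1 L2 L1 L0 hc0 hc1 hr2 ⊢
      push_cast at L2 L1 L0 hr2
      linear_combination (1 - x ^ 2) ^ 2 * D1 - x * L1 + L2 + β (m + 1) * L0
        - ((m + 2) * x ^ 3 - ladderR α β (m + 2) * x) * R1
        - β (m + 1) * (-(2 * m + 1 + 2 * α) * x ^ 2 + ladderC α t β m) * R0
        - x ^ 2 * eval x (P (m + 1)) * hr2
        - x * β (m + 1) * eval x (P m) * (hc1 - hc0)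
    have := (mul_eq_zero.1 key).resolve_right (h.monic _).ne_zero
    rw [C_eq_zero] at this
    rw [Nat.add_sub_cancel]
    linear_combination -this

end IsMonicOrthogonalFor

/-! ### First integrals and elimination of `r_n` -/

/-- The first integrals of the recurrences satisfied by the ladder coefficients. -/
theorem ladder_first_integrals {α t : ℝ} {β r c : ℕ → ℝ} (hβ : β 0 = 0) (hr0 : r 0 = 0)
    (hr : ∀ n : ℕ, r (n + 1) = r n + 2 - (2 * n + 3 + 2 * α) * β (n + 1)
      + (2 * n - 1 + 2 * α) * β n)
    (hc : ∀ n, c n = r n + r (n + 1) + 2 * (α + t))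
    (hβc : ∀ n, β (n + 1) * c (n + 1) - β n * c (n - 1) = 1) (n : ℕ) :
    -2 * (n + α) * r n - 2 * n * (α + t) + 2 * (n ^ 2 + 2 * α * n) + β n * c n * c (n - 1)
        - β n * (2 * n + 1 + 2 * α) * (2 * n - 1 + 2 * α) = 0 ∧
      r n ^ 2 + 2 * (α + t) * r n - (n ^ 2 + 2 * α * n) - 2 * β n * c n * c (n - 1)
        + β n * ((2 * n + 1 + 2 * α) * c (n - 1) + (2 * n - 1 + 2 * α) * c n) = 0 := by
  -- Both expressions vanish at `n = 0`, and their increments are combinations of the recurrences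
  -- for `r`, `c` and `β c`.
  induction n with
  | zero => simp [hβ, hr0]
  | succ n ih =>
    obtain ⟨ih₁, ih₂⟩ := ih
    have hb := hβc n
    have hrn := hr n
    have hcn := hc n
    rw [Nat.add_sub_cancel]
    push_cast
    constructor
    · linear_combination ih₁ + c n * hb - (2 * n + 1 + 2 * α) * hrn + hcn
    · linear_combination ih₂ + (2 * n + 1 + 2 * α - 2 * c n) * hb + c n * hrn
        - (r (n + 1) - r n) * hcn

/-- Put `s = r + t - α - 2n + 4(n + α) b` and let `F` be the last squared factor of the relation.
The integrals show that the expression squared on the left is `2 s F` and that the other factor on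
the right is `s²`, so both sides equal `4 s² F²`. -/
theorem betaRelation_of_first_integrals {α t u b v r : ℝ} {n : ℕ} {c d : ℝ}
    (hc : c = 2 * r + 2 + 2 * (α + t) - v + (2 * n - 1 + 2 * α) * b)
    (hd : d = 2 * r - 2 + 2 * (α + t) - u + (2 * n + 1 + 2 * α) * b)
    (h₁ : -2 * (n + α) * r - 2 * n * (α + t) + 2 * (n ^ 2 + 2 * α * n) + b * c * d
      - b * (2 * n + 1 + 2 * α) * (2 * n - 1 + 2 * α) = 0)
    (h₂ : r ^ 2 + 2 * (α + t) * r - (n ^ 2 + 2 * α * n) - 2 * b * c * d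
      + b * ((2 * n + 1 + 2 * α) * d + (2 * n - 1 + 2 * α) * c) = 0) :
    BetaRelation α t n u b v := by
  subst hc hd
  have hX : (68 * (n + α) ^ 2 - 9) * b ^ 3
      + (12 - 80 * (n + α) ^ 2 + (14 * n + 5 + 14 * α) * u + (14 * n - 5 + 14 * α) * v) * b ^ 2
      + (24 * (n + α) ^ 2 + 4 * t * (t - 2 * α) - 3 - 2 * (2 * n + 1 + 2 * α) * u
        - 2 * (2 * n - 1 + 2 * α) * v + u * v) * b
      - 2 * ((n + α) ^ 2 - t * α)
      = 2 * (r + t - α - 2 * n + 4 * (n + α) * b)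
        * (12 * (n + α) * b ^ 2 + (u + v - 8 * (n + α)) * b + n + α) := by
    -- In `h₂ + 2 * h₁` the product `b * c * d` cancels, leaving a monic quadratic in `r`;
    -- subtracting `4 * b` times it from `h₁` removes `r ^ 2`.
    linear_combination h₁ - 4 * b * (h₂ + 2 * h₁)
  have hY : 2 * (2 * n - 1 + 2 * α) * (2 * n + 1 + 2 * α) * b ^ 2
      + ((2 * n + 1 + 2 * α) * u + (2 * n - 1 + 2 * α) * v
          - 2 * (2 * n - 1 + 2 * α) * (2 * n + 1 + 2 * α)) * b
      + (n + α) ^ 2 + t * (t - 2 * α) = (r + t - α - 2 * n + 4 * (n + α) * b) ^ 2 := by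
    linear_combination -(h₂ + 2 * h₁)
  rw [BetaRelation, hX, hY]
  ring

/-! ### Transfer to the weight and conclusion -/

theorem isMonicOrthogonal_iff {α t : ℝ} (hα : 0 < α) (ht : 0 < t) (P : ℕ → ℝ[X]) :
    IsMonicOrthogonal α t P ↔ IsMonicOrthogonalFor (pjFunctional hα ht) P := by
  have e : ∀ p q : ℝ[X], pjFunctional hα ht (p * q)
      = ∫ x in (-1 : ℝ)..1, p.eval x * q.eval x * pjWeight α t x := fun p q => by
    simp only [pjFunctional_apply, eval_mul]
  constructor
  · rintro ⟨h₁, h₂, h₃⟩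
    exact ⟨h₁, h₂, fun m n hmn => by rw [e]; exact h₃ m n hmn⟩
  · rintro ⟨h₁, h₂, h₃⟩
    exact ⟨h₁, h₂, fun m n hmn => by rw [← e]; exact h₃ m n hmn⟩

theorem IsMonicOrthogonalFor.existsUnique_isRecurrenceCoeff {L : ℝ[X] →ₗ[ℝ] ℝ} {P : ℕ → ℝ[X]}
    (h : IsMonicOrthogonalFor L P) (hpos : ∀ p : ℝ[X], p ≠ 0 → 0 < L (p * p))
    (hsymm : ∀ p : ℝ[X], L (p.comp (-X)) = L p) : ∃! β : ℕ → ℝ, IsRecurrenceCoeff P β := by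
  choose b hb using h.exists_recurrence hpos hsymm
  refine ⟨fun n => if n = 0 then 0 else b (n - 1), ⟨by simp, h.X_mul_zero hpos hsymm,
    fun n => by simpa using hb n⟩, fun β hβ => ?_⟩
  funext n
  rcases n with _ | n
  · exact hβ.beta_zero
  · have := (hβ.rec_succ n).symm.trans (hb n)
    have hmul : C (β (n + 1)) * P n = C (b n) * P n := add_left_cancel this
    have hC : C (β (n + 1)) = C (b n) := mul_right_cancel₀ (h.monic n).ne_zero hmul
    simpa using C_injective hC

theorem IsMonicOrthogonalFor.betaRelation {α t : ℝ} {L : ℝ[X] →ₗ[ℝ] ℝ} {P : ℕ → ℝ[X]} {β : ℕ → ℝ}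
    (h : IsMonicOrthogonalFor L P) (hpos : ∀ p : ℝ[X], p ≠ 0 → 0 < L (p * p))
    (hpearson : ∀ p : ℝ[X], L ((1 - X ^ 2) ^ 2 * derivative p
      + (C (4 + 2 * α) * X ^ 3 - C (4 + 2 * α + 2 * t) * X) * p) = 0)
    (hβ : IsRecurrenceCoeff P β) {n : ℕ} (hn : 1 ≤ n) :
    BetaRelation α t n ((2 * n - 3 + 2 * α) * β (n - 1)) (β n)
      ((2 * n + 3 + 2 * α) * β (n + 1)) := by
  -- At `n = 0` the index `n - 1` truncates to `0`, which is harmless because `β 0 = 0`.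
  have hrec : ∀ n, X * P n = P (n + 1) + C (β n) * P (n - 1) := fun n => by
    rcases n with _ | n
    · simp [hβ.rec_zero, hβ.beta_zero]
    · exact hβ.rec_succ n
  obtain ⟨h₁, h₂⟩ := ladder_first_integrals (α := α) (t := t) (β := β) (r := ladderR α β)
    (c := ladderC α t β) hβ.beta_zero (by simp [ladderR, hβ.beta_zero]) (ladderR_succ α β)
    (fun _ => rfl) (h.beta_mul_ladderC hpos hrec hβ.beta_zero hpearson) n
  refine betaRelation_of_first_integrals ?_ ?_ h₁ h₂
  · rw [ladderC, ladderR_succ]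
    ring
  -- The recurrence for `r` is read backwards to express `c_{n-1}` through `r_n`; this needs `n ≥
  -- 1`.
  · obtain ⟨m, rfl⟩ := Nat.exists_eq_add_of_le' hn
    rw [Nat.add_sub_cancel, ladderC, ladderR_succ]
    push_cast
    ring

theorem mainTheorem1 (α t : ℝ) (hα : 0 < α) (ht : 0 < t) :
    (∃! P : ℕ → Polynomial ℝ, IsMonicOrthogonal α t P) ∧
    ∀ P : ℕ → Polynomial ℝ, IsMonicOrthogonal α t P →
      (∃! β : ℕ → ℝ, IsRecurrenceCoeff P β) ∧
      ∀ β : ℕ → ℝ, IsRecurrenceCoeff P β →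
        (∀ n : ℕ, 1 ≤ n →
          BetaRelation α t n ((2 * n - 3 + 2 * α) * β (n - 1)) (β n)
            ((2 * n + 3 + 2 * α) * β (n + 1))) ∧
        (∀ b : ℝ, BetaRelation α t 0 ((-3 + 2 * α) * b) (β 0) ((3 + 2 * α) * β 1)) := by
  have hpos : ∀ p : ℝ[X], p ≠ 0 → 0 < pjFunctional hα ht (p * p) :=
    fun _ => pjFunctional_mul_self_pos hα ht
  simp only [isMonicOrthogonal_iff hα ht]
  refine ⟨?_, fun P hP => ⟨hP.existsUnique_isRecurrenceCoeff hpos (pjFunctional_comp_neg hα ht),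
    fun β hβ => ⟨fun n hn => hP.betaRelation hpos (pjFunctional_pearson hα ht) hβ hn,
      fun b => ?_⟩⟩⟩
  · obtain ⟨P, hP⟩ := exists_isMonicOrthogonalFor _ hpos
    exact ⟨P, hP, fun Q hQ => hQ.unique hpos hP⟩
  -- With `β 0 = 0` both neighbours drop out and each side is `4 α² (α - t)²`.
  · rw [BetaRelation, hβ.beta_zero]
    push_cast
    ring
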